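/- Let $M$ be a smooth (Hausdorff) manifold of dimension $2n$ with an almost Kähler structure $(g,J,\omega)$: that is, $J$ is a smooth almost complex structure on $M$, $g$ is a smooth Riemannian metric with $g(JX,JY)=g(X,Y)$, and the $2$-form $\omega(X,Y)=g(JX,Y)$ satisfies $d\omega=0$. For a smooth $(1,0)$-form $\zeta$ (a complex $1$-form vanishing on the $(-i)$-eigenbundle $T^{0,1}M$ of $J$), let $\partial\zeta=(d\zeta)^{2,0}$ and $\overline\partial\zeta=(d\zeta)^{1,1}$ be the components of $d\zeta$ of type $(2,0)$ and $(1,1)$ with respect to $J$. Assume that $M$ admits a global unitary $(1,0)$-coframe, i.e. smooth $(1,0)$-forms $\zeta_1,\dots,\zeta_n$ on $M$ which at every point are dual to a basis $Z_1,\dots,Z_n$ of $T^{1,0}M$ (the $i$-eigenbundle of $J$) with $g(Z_i,\overline{Z_j})=\delta_{ij}$ ($g$ extended complex-bilinearly), such that $$\partial\zeta_i=\overline\partial\zeta_i=0,\qquad i=1,\dots,n.$$ Then $J$ is integrable, that is, its Nijenhuis tensor $N(X,Y)=[JX,JY]-J[JX,Y]-J[X,JY]-[X,Y]$ vanishes for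 all smooth vector fields $X,Y$ on $M$; hence $(M,g,J,\omega)$ is Kähler (that is, $J$ is integrable and $d\omega=0$). -/

import Mathlib

open Set Bundle Manifold
open scoped ContDiff TensorProduct

noncomputable section

namespace AlmostHermitian

/-! ### The exterior derivative on a manifold -/

section ExteriorDerivative

variable {E : Type*} [NormedAddCommGroup E] [NormedSpace ℝ E]
  {H : Type*} [TopologicalSpace H] (I : ModelWithCorners ℝ E H)
  {M : Type*} [TopologicalSpace M] [ChartedSpace H M]
  {F : Type*} [NormedAddCommGroup F] [NormedSpace ℝ F]

/-- The expression in the chart at `x₀` of an `F`-valued `k`-form `α` on `M`: the pullback of `α`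
by the inverse of the chart, a `k`-form on the model vector space. -/
def formInChart {k : ℕ} (α : ∀ x : M, TangentSpace I x [⋀^Fin k]→L[ℝ] F) (x₀ : M) :
    E → E [⋀^Fin k]→L[ℝ] F := fun y =>
  (α ((extChartAt I x₀).symm y)).compContinuousLinearMap
    (mfderivWithin 𝓘(ℝ, E) I (extChartAt I x₀).symm (range I) y)

/-- The exterior derivative `dα` of an `F`-valued `k`-form on `M`. At the point `x₀` it is computed
in the chart at `x₀`: write `α` in that chart, take the exterior derivative on the model vector
space, and pull the result back to `T_{x₀}M` by the chart. -/
def extD {k : ℕ} (α : ∀ x : M, TangentSpace I x [⋀^Fin k]→L[ℝ] F) (x₀ : M) :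
    TangentSpace I x₀ [⋀^Fin (k + 1)]→L[ℝ] F :=
  (extDerivWithin (formInChart I α x₀) (range I) (extChartAt I x₀ x₀) :
      E [⋀^Fin (k + 1)]→L[ℝ] F).compContinuousLinearMap
    (mfderiv I 𝓘(ℝ, E) (extChartAt I x₀) x₀)

end ExteriorDerivative

lemma update_one_pair {V : Type*} (u v w : V) : Function.update ![u, v] 1 w = ![u, w] := by
  ext i
  fin_cases i <;> rfl

lemma continuous_bilin_apply {E : Type*} [NormedAddCommGroup E] [NormedSpace ℝ E]
    (B : E →L[ℝ] E →L[ℝ] ℝ) (J : E →L[ℝ] E) :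
    Continuous fun v : Fin 2 → E => B (J (v 0)) (v 1) := by
  fun_prop

/-! ### Complexification of a real vector space, and types -/

section Complexification

/-- The base change `A ⊗ V` of a real vector space to a real algebra `A`. -/
abbrev ExtendScalars (A V : Type*) [CommRing A] [Algebra ℝ A] [AddCommGroup V] [Module ℝ V] :
    Type _ := A ⊗[ℝ] V

/-- The complexification `ℂ ⊗ V` of a real vector space. -/
abbrev Cplx (V : Type*) [AddCommGroup V] [Module ℝ V] : Type _ := ExtendScalars ℂ V

variable {V : Type*} [AddCommGroup V] [Module ℝ V]

/-- Complex conjugation `a ⊗ v ↦ conj a ⊗ v` on `ℂ ⊗ V`. -/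
def conjC : Cplx V →ₗ[ℝ] Cplx V :=
  LinearMap.rTensor V Complex.conjAe.toLinearMap

lemma conjC_tmul (a : ℂ) (v : V) :
    conjC (a ⊗ₜ[ℝ] v : Cplx V) = (starRingEnd ℂ a) ⊗ₜ[ℝ] v := by
  simp [conjC]

/-- The complex-linear extension to `ℂ ⊗ V` of a real-linear map `V → ℂ`. -/
def extendLin (f : V →ₗ[ℝ] ℂ) : Cplx V →ₗ[ℂ] ℂ :=
  f.liftBaseChange ℂ

lemma extendLin_tmul (f : V →ₗ[ℝ] ℂ) (a : ℂ) (v : V) :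
    extendLin f (a ⊗ₜ[ℝ] v) = a * f v := by
  simp [extendLin]

/-- The complex-bilinear extension to `ℂ ⊗ V` of a complex-valued real-bilinear map on `V`. -/
def extendBilin (B : V →ₗ[ℝ] V →ₗ[ℝ] ℂ) : Cplx V →ₗ[ℂ] Cplx V →ₗ[ℂ] ℂ :=
  LinearMap.liftBaseChange ℂ
    ((LinearMap.liftBaseChangeEquiv ℂ).toLinearMap.restrictScalars ℝ ∘ₗ B)

lemma extendBilin_tmul (B : V →ₗ[ℝ] V →ₗ[ℝ] ℂ) (a b : ℂ) (u v : V) :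
    extendBilin B (a ⊗ₜ[ℝ] u) (b ⊗ₜ[ℝ] v) = a * (b * B u v) := by
  simp [extendBilin]

/-- The complex-bilinear extension to `ℂ ⊗ V` of a complex-valued alternating `2`-form on `V`. -/
def extendTwoForm [TopologicalSpace V] (α : V [⋀^Fin 2]→L[ℝ] ℂ) :
    Cplx V →ₗ[ℂ] Cplx V →ₗ[ℂ] ℂ :=
  extendBilin <| LinearMap.mk₂ ℝ (fun u v => α ![u, v])
    (fun u u' v => by simpa using α.toMultilinearMap.cons_add ![v] u u')
    (fun c u v => by simpa using α.toMultilinearMap.cons_smul ![v] c u)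
    (fun u v v' => by
      have h := α.map_update_add ![u, 0] 1 v v'
      simpa [update_one_pair] using h)
    (fun c u v => by
      have h := α.map_update_smul ![u, 0] 1 c v
      simpa [update_one_pair] using h)

lemma extendTwoForm_tmul [TopologicalSpace V] (α : V [⋀^Fin 2]→L[ℝ] ℂ) (a b : ℂ) (u v : V) :
    extendTwoForm α (a ⊗ₜ[ℝ] u) (b ⊗ₜ[ℝ] v) = a * (b * α ![u, v]) := by
  simp [extendTwoForm, extendBilin_tmul]

section Types

variable (J : V →ₗ[ℝ] V)

/-- The complex-linear extension of `J` to `ℂ ⊗ V`. -/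
def extendEnd : Cplx V →ₗ[ℂ] Cplx V :=
  J.baseChange ℂ

lemma extendEnd_tmul (a : ℂ) (v : V) : extendEnd J (a ⊗ₜ[ℝ] v) = a ⊗ₜ[ℝ] J v := by
  simp [extendEnd]

/-- `V^{1,0}`, the eigenspace in `ℂ ⊗ V` of `J` for the eigenvalue `i`. -/
def space10 : Submodule ℂ (Cplx V) :=
  Module.End.eigenspace (extendEnd J) Complex.I

/-- `V^{0,1}`, the eigenspace in `ℂ ⊗ V` of `J` for the eigenvalue `-i`. -/
def space01 : Submodule ℂ (Cplx V) :=
  Module.End.eigenspace (extendEnd J) (-Complex.I)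

lemma mem_space10 (Z : Cplx V) : Z ∈ space10 J ↔ extendEnd J Z = Complex.I • Z :=
  Module.End.mem_eigenspace_iff

lemma mem_space01 (Z : Cplx V) : Z ∈ space01 J ↔ extendEnd J Z = -Complex.I • Z :=
  Module.End.mem_eigenspace_iff

/-- `Z ↦ (Z - i J Z) / 2`; if `J² = -1`, the projection onto `V^{1,0}` along `V^{0,1}`. -/
def proj10 : Cplx V →ₗ[ℂ] Cplx V :=
  (1 / 2 : ℂ) • (LinearMap.id - Complex.I • extendEnd J)

/-- `Z ↦ (Z + i J Z) / 2`; if `J² = -1`, the projection onto `V^{0,1}` along `V^{1,0}`. -/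
def proj01 : Cplx V →ₗ[ℂ] Cplx V :=
  (1 / 2 : ℂ) • (LinearMap.id + Complex.I • extendEnd J)

/-- The component of type `(2,0)` of a complex-valued `2`-form on `V`. -/
def part20 [TopologicalSpace V] (α : V [⋀^Fin 2]→L[ℝ] ℂ) : Cplx V →ₗ[ℂ] Cplx V →ₗ[ℂ] ℂ :=
  (extendTwoForm α).compl₁₂ (proj10 J) (proj10 J)

/-- The component of type `(1,1)` of a complex-valued `2`-form on `V`. -/
def part11 [TopologicalSpace V] (α : V [⋀^Fin 2]→L[ℝ] ℂ) : Cplx V →ₗ[ℂ] Cplx V →ₗ[ℂ] ℂ :=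
  (extendTwoForm α).compl₁₂ (proj10 J) (proj01 J)
    + (extendTwoForm α).compl₁₂ (proj01 J) (proj10 J)

end Types

end Complexification

/-! ### Almost Hermitian structures -/

variable {n : ℕ} {M : Type*} [TopologicalSpace M]
  [ChartedSpace (EuclideanSpace ℝ (Fin (2 * n))) M] [IsManifold (𝓡 (2 * n)) ∞ M]

variable (n M) in
/-- An almost Hermitian structure `(g, J)` on a smooth `2n`-dimensional manifold `M`: a smooth
Riemannian metric `g` and a smooth almost complex structure `J` preserving `g`. -/
structure Structure where
  /-- the Riemannian metric -/
  g : ContMDiffRiemannianMetric (𝓡 (2 * n)) ∞ (EuclideanSpace ℝ (Fin (2 * n)))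
    (fun x : M => TangentSpace (𝓡 (2 * n)) x)
  /-- the almost complex structure -/
  J : ∀ x : M, TangentSpace (𝓡 (2 * n)) x →L[ℝ] TangentSpace (𝓡 (2 * n)) x
  contMDiff_J : ContMDiff (𝓡 (2 * n))
    ((𝓡 (2 * n)).prod
      𝓘(ℝ, EuclideanSpace ℝ (Fin (2 * n)) →L[ℝ] EuclideanSpace ℝ (Fin (2 * n)))) ∞
    (fun x => TotalSpace.mk'
      (EuclideanSpace ℝ (Fin (2 * n)) →L[ℝ] EuclideanSpace ℝ (Fin (2 * n)))
      (E := fun x : M => TangentSpace (𝓡 (2 * n)) x →L[ℝ] TangentSpace (𝓡 (2 * n)) x) x (J x))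
  J_J : ∀ (x : M) (v : TangentSpace (𝓡 (2 * n)) x), J x (J x v) = -v
  g_J_J : ∀ (x : M) (v w : TangentSpace (𝓡 (2 * n)) x),
    g.inner x (J x v) (J x w) = g.inner x v w

namespace Structure

variable (S : Structure n M)

lemma g_J_self (x : M) (v : TangentSpace (𝓡 (2 * n)) x) : S.g.inner x (S.J x v) v = 0 := by
  have h := S.g_J_J x (S.J x v) v
  rw [S.J_J, map_neg, neg_apply, S.g.symm x v] at h
  linarith

/-- The fundamental form `ω(X, Y) = g(JX, Y)`. -/
def fundamentalForm (x : M) : TangentSpace (𝓡 (2 * n)) x [⋀^Fin 2]→L[ℝ] ℝ where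
  toFun v := S.g.inner x (S.J x (v 0)) (v 1)
  map_update_add' := by
    intro _ v i a b
    fin_cases i <;> simp [Function.update]
  map_update_smul' := by
    intro _ v i c a
    fin_cases i <;> simp [Function.update]
  cont := continuous_bilin_apply (E := EuclideanSpace ℝ (Fin (2 * n))) (S.g.inner x) (S.J x)
  map_eq_zero_of_eq' := by
    intro v i j hij hne
    have h01 : v 0 = v 1 := by
      fin_cases i <;> fin_cases j <;> simp_all
    change S.g.inner x (S.J x (v 0)) (v 1) = 0
    rw [h01]
    exact S.g_J_self x _

/-- `(g, J, ω)` is almost Kähler: `dω = 0`. -/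
def IsAlmostKahler : Prop :=
  ∀ x : M, extD (𝓡 (2 * n)) S.fundamentalForm x = 0

/-- The vector field `JX`. -/
def Jfield (X : ∀ x : M, TangentSpace (𝓡 (2 * n)) x) (x : M) : TangentSpace (𝓡 (2 * n)) x :=
  S.J x (X x)

/-- The Nijenhuis tensor `N(X, Y) = [JX, JY] - J[JX, Y] - J[X, JY] - [X, Y]`. -/
def nijenhuis (X Y : ∀ x : M, TangentSpace (𝓡 (2 * n)) x) (x : M) :
    TangentSpace (𝓡 (2 * n)) x :=
  VectorField.mlieBracket (𝓡 (2 * n)) (S.Jfield X) (S.Jfield Y) x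
    - S.J x (VectorField.mlieBracket (𝓡 (2 * n)) (S.Jfield X) Y x)
    - S.J x (VectorField.mlieBracket (𝓡 (2 * n)) X (S.Jfield Y) x)
    - VectorField.mlieBracket (𝓡 (2 * n)) X Y x

/-- `J` is integrable: `N(X, Y) = 0` for all smooth vector fields `X`, `Y` on `M`. -/
def IsIntegrable : Prop :=
  ∀ X Y : ∀ x : M, TangentSpace (𝓡 (2 * n)) x,
    ContMDiff (𝓡 (2 * n)) (𝓡 (2 * n)).tangent ∞
      (fun x => (⟨x, X x⟩ : TangentBundle (𝓡 (2 * n)) M)) →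
    ContMDiff (𝓡 (2 * n)) (𝓡 (2 * n)).tangent ∞
      (fun x => (⟨x, Y x⟩ : TangentBundle (𝓡 (2 * n)) M)) →
    ∀ x : M, S.nijenhuis X Y x = 0

/-- `(g, J, ω)` is Kähler: `J` is integrable and `dω = 0`. -/
def IsKahler : Prop :=
  S.IsIntegrable ∧ S.IsAlmostKahler

/-! ### Forms of type `(1,0)` and unitary coframes -/

/-- `T^{1,0}_x M`, the eigenspace of `J` in `ℂ ⊗ T_xM` for the eigenvalue `i`. -/
abbrev T10 (x : M) : Submodule ℂ (Cplx (TangentSpace (𝓡 (2 * n)) x)) :=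
  space10 (S.J x).toLinearMap

/-- `T^{0,1}_x M`, the eigenspace of `J` in `ℂ ⊗ T_xM` for the eigenvalue `-i`. -/
abbrev T01 (x : M) : Submodule ℂ (Cplx (TangentSpace (𝓡 (2 * n)) x)) :=
  space01 (S.J x).toLinearMap

/-- A smooth global `(1,0)`-form on `M`: a smooth complex-valued `1`-form whose complex-linear
extension vanishes on `T^{0,1}M`. -/
structure Form10 where
  /-- the value at each point, as a real-linear map `T_xM → ℂ` -/
  toFun : ∀ x : M, TangentSpace (𝓡 (2 * n)) x →L[ℝ] ℂ
  contMDiff : ContMDiff (𝓡 (2 * n))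
    ((𝓡 (2 * n)).prod 𝓘(ℝ, EuclideanSpace ℝ (Fin (2 * n)) →L[ℝ] ℂ)) ∞
    (fun x => TotalSpace.mk' (EuclideanSpace ℝ (Fin (2 * n)) →L[ℝ] ℂ)
      (E := fun x : M => TangentSpace (𝓡 (2 * n)) x →L[ℝ] ℂ) x (toFun x))
  type10 : ∀ x : M, ∀ Z ∈ S.T01 x, extendLin (toFun x).toLinearMap Z = 0

namespace Form10

variable {S} (ζ : S.Form10)

/-- The complex-linear extension of the `(1,0)`-form `ζ` to `ℂ ⊗ T_xM`. -/
def extend (x : M) : Cplx (TangentSpace (𝓡 (2 * n)) x) →ₗ[ℂ] ℂ :=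
  extendLin (ζ.toFun x).toLinearMap

/-- The exterior derivative `dζ` of a `(1,0)`-form. -/
def d (x : M) : TangentSpace (𝓡 (2 * n)) x [⋀^Fin 2]→L[ℝ] ℂ :=
  extD (𝓡 (2 * n))
    (fun y => ContinuousAlternatingMap.ofSubsingleton ℝ (TangentSpace (𝓡 (2 * n)) y) ℂ
      (0 : Fin 1) (ζ.toFun y)) x

/-- `∂ζ`, the `(2,0)`-part of `dζ`, for a `(1,0)`-form `ζ`. -/
def del (x : M) : Cplx (TangentSpace (𝓡 (2 * n)) x) →ₗ[ℂ]
    Cplx (TangentSpace (𝓡 (2 * n)) x) →ₗ[ℂ] ℂ :=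
  part20 (S.J x).toLinearMap (ζ.d x)

/-- `∂̄ζ`, the `(1,1)`-part of `dζ`, for a `(1,0)`-form `ζ`. -/
def delbar (x : M) : Cplx (TangentSpace (𝓡 (2 * n)) x) →ₗ[ℂ]
    Cplx (TangentSpace (𝓡 (2 * n)) x) →ₗ[ℂ] ℂ :=
  part11 (S.J x).toLinearMap (ζ.d x)

end Form10

/-- The complex-bilinear extension of `g` to `ℂ ⊗ T_xM`. -/
def gC (x : M) : Cplx (TangentSpace (𝓡 (2 * n)) x) →ₗ[ℂ]
    Cplx (TangentSpace (𝓡 (2 * n)) x) →ₗ[ℂ] ℂ :=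
  extendBilin <| LinearMap.mk₂ ℝ (fun u v => ((S.g.inner x u v : ℝ) : ℂ))
    (by simp) (by simp) (by simp) (by simp)

/-- `ζ₁, …, ζₙ` is a unitary `(1,0)`-coframe: at every point it is dual to a basis `Z₁, …, Zₙ` of
`T^{1,0}M` which is unitary, that is, `g(Z_i, conj Z_j) = δ_ij`. -/
def IsUnitaryCoframe (ζ : Fin n → S.Form10) : Prop :=
  ∀ x : M, ∃ Z : Module.Basis (Fin n) ℂ (S.T10 x),
    (∀ i j, (ζ i).extend x (Z j) = if i = j then 1 else 0) ∧
    ∀ i j, S.gC x (Z i) (conjC (Z j : Cplx (TangentSpace (𝓡 (2 * n)) x))) =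
      if i = j then 1 else 0

end Structure

end AlmostHermitian

end

/-! ### Algebra: a conjugate-bilinear bracket on a Hermitian space. -/

section LocalComputation

open Filter Topology

variable {E W : Type*} [NormedAddCommGroup E] [NormedSpace ℝ E] [NormedAddCommGroup W]

/-! Assemble the forms `ζ i` into one map `α : TM → ℂⁿ`. On each tangent space it is a real
isomorphism that turns `J` into multiplication by `i` and makes `ω(u, v) = -2 Im ⟨α v, α u⟩`, the
pullback of a constant form. Since `∂ζ_i = ∂̄ζ_i = 0`, `dα` has type (0,2): `dα(u, v) = b(α u, α v)`
with `b` alternating and conjugate-linear in both slots, depending on the point.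

The identity `d²α = 0` says that the cyclic sum of `(D_u b)(v, w) + b(b(u, v), w)` is zero. The
derivative term is conjugate-linear in `v` and `w`, whereas in `b(b(u, v), w)` two conjugations
cancel, making it complex-linear in `u` and `v`. No other term has a part of that type, so `b(b(u,
v), w) = 0`. Next, `dω = 0` says that the cyclic sum of `Im ⟨w, b(u, v)⟩` is zero; each inner
product is conjugate-linear in all three arguments, so the complex sum vanishes too. Taking `w =
b(u, v)` kills two terms and leaves `‖b(u, v)‖² = 0`.

Hence `α` is closed, and Cartan's formula gives `N = 0`. The algebra is
`conjBilinear_eq_zero_of_bianchi`; `curlForm_eq_zero` derives its hypotheses from a coframe on a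
vector space, `nijenhuis_eq_zero_of_curlForm_eq_zero` concludes there, and charts transfer both to
`M`. -/

/-- A conjugate-bilinear alternating product on a Hermitian space vanishes if it satisfies the
Bianchi identity up to terms `D` that are conjugate-linear in the last two arguments, and if the
associated real three-form vanishes. -/
theorem conjBilinear_eq_zero_of_bianchi [InnerProductSpace ℂ W] (b : W → W → W) (D : W → W → W → W)
    (hb : ∀ u v, b (Complex.I • u) v = -(Complex.I • b u v))
    (hb' : ∀ u v, b u v = -b v u)
    (hD : ∀ u v w, D u (Complex.I • v) w = -(Complex.I • D u v w))
    (hD' : ∀ u v w, D u v w = -D u w v)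
    (hbianchi : ∀ u v w, D u v w + D v w u + D w u v
      + (b (b u v) w + b (b v w) u + b (b w u) v) = 0)
    (hω : ∀ u v w, (inner ℂ w (b u v)).im + (inner ℂ u (b v w)).im
      + (inner ℂ v (b w u)).im = 0) (u v : W) : b u v = 0 := by
  have hII : ∀ x : W, Complex.I • Complex.I • x = -x := fun x => by
    rw [smul_smul, Complex.I_mul_I, neg_one_smul]
  have hbr : ∀ u v, b u (Complex.I • v) = -(Complex.I • b u v) := fun u v => by
    rw [hb', hb, hb' u v, smul_neg]
  have hbn : ∀ u v, b (-u) v = -b u v := fun u v => by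
    rw [← hII u, hb, hb, smul_neg, neg_neg, hII]
  have hDr : ∀ u v w, D u v (Complex.I • w) = -(Complex.I • D u v w) := fun u v w => by
    rw [hD', hD, hD' u v w, smul_neg]
  have hbb : ∀ u v w, b (b u v) w = 0 := by
    intro u v w
    -- The combination `h1 - h2 - h3 - h4` is four times the projection onto the part complex-linear
    -- in both `u` and `v`. Every term except `b (b u v) w` is conjugate-linear in `u` or in `v`,
    -- and cancels.
    have h1 := hbianchi u v w
    have h2 := congrArg (fun x => Complex.I • x) (hbianchi (Complex.I • u) v w)
    have h3 := congrArg (fun x => Complex.I • x) (hbianchi u (Complex.I • v) w)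
    have h4 := hbianchi (Complex.I • u) (Complex.I • v) w
    simp only [hb, hbr, hbn, hD, hDr, smul_add, smul_neg, hII, smul_zero, neg_neg] at h1 h2 h3 h4
    have h : (4 : ℂ) • b (b u v) w = 0 := by
      rw [show (4 : ℂ) • b (b u v) w = b (b u v) w + b (b u v) w + b (b u v) w + b (b u v) w by
        module]
      linear_combination (norm := module) h1 - h2 - h3 - h4
    exact (smul_eq_zero.1 h).resolve_left (by norm_num)
  have hcyc : ∀ u v w, inner ℂ w (b u v) + inner ℂ u (b v w) + inner ℂ v (b w u) = 0 := by
    intro u v w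
    -- The sum is conjugate-linear in `u`, so replacing `u` by `i u` multiplies it by `-i` and
    -- exposes its real part.
    have h2 := hω (Complex.I • u) v w
    simp only [hb, hbr, inner_neg_right, inner_smul_right, inner_smul_left, Complex.conj_I,
      neg_mul, Complex.neg_im, Complex.I_mul_im] at h2
    apply Complex.ext
    · simp only [Complex.add_re, Complex.zero_re]
      linarith
    · simpa using hω u v w
  have h := hcyc u v (b u v)
  rw [hbb, hb' v (b u v), hbb] at h
  simpa using h

/-! ### Calculus of vector-valued one-forms on a vector space. -/

variable [NormedSpace ℝ W]

/-- The exterior derivative of a vector-valued one-form `α` on a vector space. -/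
noncomputable def curlForm (α : E → E →L[ℝ] W) (y v w : E) : W :=
  fderiv ℝ α y v w - fderiv ℝ α y w v

theorem curlForm_swap (α : E → E →L[ℝ] W) (y v w : E) :
    curlForm α y v w = -curlForm α y w v := by
  simp [curlForm]

theorem curlForm_comp {F : Type*} [NormedAddCommGroup F] [NormedSpace ℝ F] (L : W →L[ℝ] F)
    {α : E → E →L[ℝ] W} {y : E} (hα : DifferentiableAt ℝ α y) (u v : E) :
    curlForm (fun z => L.comp (α z)) y u v = L (curlForm α y u v) := by
  have h := ((hasFDerivAt_const L y).clm_comp hα.hasFDerivAt).fderiv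
  simp [curlForm, h]

/-- Invertible operators form an open set. -/
theorem eventually_isInvertible [CompleteSpace E] {α : E → E →L[ℝ] W} {y₀ : E} (hα : ContinuousAt α y₀)
    (e : E ≃L[ℝ] W) (he : (e : E →L[ℝ] W) = α y₀) :
    ∀ᶠ y in 𝓝 y₀, ∃ f : E ≃L[ℝ] W, (f : E →L[ℝ] W) = α y := by
  have h := ContinuousLinearEquiv.nhds e
  rw [he] at h
  exact hα h

theorem differentiableAt_inverse_comp [CompleteSpace E] {α : E → E →L[ℝ] W} {y₀ : E}
    (hα : DifferentiableAt ℝ α y₀) (e : E ≃L[ℝ] W) (he : (e : E →L[ℝ] W) = α y₀) :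
    DifferentiableAt ℝ (fun y => (α y).inverse) y₀ := by
  have h1 : ContDiffAt ℝ 1 ContinuousLinearMap.inverse (α y₀) := by
    rw [← he]
    exact contDiffAt_map_inverse e
  exact (h1.differentiableAt one_ne_zero).comp y₀ hα

/-- Cartan's formula for the exterior derivative of a one-form. -/
theorem apply_lieBracket {α : E → E →L[ℝ] W} {X Y : E → E} {y : E}
    (hα : DifferentiableAt ℝ α y) (hX : DifferentiableAt ℝ X y) (hY : DifferentiableAt ℝ Y y) :
    α y (VectorField.lieBracket ℝ X Y y) =
      fderiv ℝ (fun z => α z (Y z)) y (X y) - fderiv ℝ (fun z => α z (X z)) y (Y y)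
        - curlForm α y (X y) (Y y) := by
  rw [(hα.hasFDerivAt.clm_apply hX.hasFDerivAt).fderiv,
    (hα.hasFDerivAt.clm_apply hY.hasFDerivAt).fderiv]
  simp only [VectorField.lieBracket, curlForm, map_sub, add_apply,
    ContinuousLinearMap.comp_apply, ContinuousLinearMap.flip_apply]
  abel

theorem extDeriv_ofSubsingleton_apply {α : E → E →L[ℝ] W} {y : E} (hα : DifferentiableAt ℝ α y)
    (u v : E) :
    extDeriv (fun y => ContinuousAlternatingMap.ofSubsingleton ℝ E W (0 : Fin 1) (α y)) y ![u, v] =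
      curlForm α y u v := by
  have hd : DifferentiableAt ℝ
      (fun y => ContinuousAlternatingMap.ofSubsingleton ℝ E W (0 : Fin 1) (α y)) y :=
    (ContinuousAlternatingMap.ofSubsingletonLIE (𝕜 := ℝ) (E := E) (F := W)
      (0 : Fin 1)).differentiableAt.comp y hα
  have happ : ∀ u v, fderiv ℝ (fun z => α z v) y u = fderiv ℝ α y u v := fun u v => by
    rw [(hα.hasFDerivAt.clm_apply (hasFDerivAt_const v y)).fderiv]
    simp
  rw [extDeriv_apply hd, Fin.sum_univ_two]
  simp [curlForm, Fin.removeNth, happ, sub_eq_add_neg]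

/-- If the fundamental form of the Hermitian structure defined by the coframe `α` is closed at `y₀`,
then the exterior derivative of `α` satisfies a cyclic identity. -/
theorem cyclic_curlForm_of_extDeriv_eq_zero [InnerProductSpace ℂ W]
    {α : E → E →L[ℝ] W} {y₀ : E}
    (hα : DifferentiableAt ℝ α y₀) (Ω : W [⋀^Fin 2]→L[ℝ] ℝ) (c : ℝ) (hc : c ≠ 0)
    (hΩ : ∀ u v, Ω ![u, v] = c * (inner ℂ v u).im)
    (hd : extDeriv (fun y => Ω.compContinuousLinearMap (α y)) y₀ = 0) (u v w : E) :
    (inner ℂ (α y₀ w) (curlForm α y₀ u v)).im + (inner ℂ (α y₀ u) (curlForm α y₀ v w)).im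
      + (inner ℂ (α y₀ v) (curlForm α y₀ w u)).im = 0 := by
  have hdiff : DifferentiableAt ℝ (fun y => Ω.compContinuousLinearMap (α y)) y₀ :=
    (differentiableAt_const Ω).continuousAlternatingMapCompContinuousLinearMap hα
  -- `Ω` is constant, so the derivative falls only on the two copies of `α`.
  have happ : ∀ u v w, fderiv ℝ (fun y => Ω ![α y v, α y w]) y₀ u =
      c * (inner ℂ (α y₀ w) (fderiv ℝ α y₀ u v) + inner ℂ (fderiv ℝ α y₀ u w) (α y₀ v)).im := by
    intro u v w
    have h1 : ∀ v, HasFDerivAt (fun y => α y v) _ y₀ := fun v =>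
      hα.hasFDerivAt.clm_apply (hasFDerivAt_const v y₀)
    have h2 := ((Complex.imCLM.hasFDerivAt.comp y₀ ((h1 w).inner ℂ (h1 v))).const_mul c).fderiv
    simp only [hΩ]
    simp only [Function.comp_def, Complex.imCLM_apply] at h2
    rw [h2]
    simp
  have h := congrArg (fun η => η ![u, v, w]) hd
  beta_reduce at h
  have hcomp : ∀ (L : E →L[ℝ] W) (a b : E), L ∘ ![a, b] = ![L a, L b] := fun L a b => by
    ext i
    fin_cases i <;> rfl
  have h1 : Fin.removeNth 1 ![u, v, w] = ![u, w] := by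
    ext i
    fin_cases i <;> rfl
  have h2 : Fin.removeNth 2 ![u, v, w] = ![u, v] := by
    ext i
    fin_cases i <;> rfl
  rw [extDeriv_apply hdiff, Fin.sum_univ_three] at h
  simp only [ContinuousAlternatingMap.compContinuousLinearMap_apply, Fin.removeNth_zero,
    Fin.tail_vecCons, h1, h2, hcomp, happ] at h
  simp at h
  -- Hermitian symmetry moves every derivative of `α` to the second slot, where the six terms pair
  -- up into three curls.
  have hconj : ∀ x y : W, (inner ℂ x y).im = -(inner ℂ y x).im := fun x y => by
    rw [← inner_conj_symm, Complex.conj_im]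
  simp only [curlForm, inner_sub_right, Complex.sub_im]
  rw [hconj _ (α y₀ v), hconj _ (α y₀ u), hconj _ (α y₀ u)] at h
  have h3 : c * ((inner ℂ (α y₀ w) (fderiv ℝ α y₀ u v)).im
      - (inner ℂ (α y₀ w) (fderiv ℝ α y₀ v u)).im
      + ((inner ℂ (α y₀ u) (fderiv ℝ α y₀ v w)).im - (inner ℂ (α y₀ u) (fderiv ℝ α y₀ w v)).im)
      + ((inner ℂ (α y₀ v) (fderiv ℝ α y₀ w u)).im
        - (inner ℂ (α y₀ v) (fderiv ℝ α y₀ u w)).im)) = 0 := by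
    linear_combination h
  exact (mul_eq_zero.1 h3).resolve_left hc

variable [InnerProductSpace ℂ W] [IsScalarTower ℝ ℂ W] [CompleteSpace E]

/-- If `α` identifies each tangent space with a complex vector space, and `α` is closed at `y₀`,
then the Nijenhuis tensor of the corresponding almost complex structure vanishes at `y₀`. -/
theorem nijenhuis_eq_zero_of_curlForm_eq_zero {α : E → E →L[ℝ] W} {y₀ : E}
    (hα : DifferentiableAt ℝ α y₀) (e : E ≃L[ℝ] W) (he : (e : E →L[ℝ] W) = α y₀)
    (hcurl : ∀ u v, curlForm α y₀ u v = 0) {X Y JX JY : E → E}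
    (hX : DifferentiableAt ℝ X y₀) (hY : DifferentiableAt ℝ Y y₀)
    (hJX : ∀ᶠ y in 𝓝 y₀, α y (JX y) = Complex.I • α y (X y))
    (hJY : ∀ᶠ y in 𝓝 y₀, α y (JY y) = Complex.I • α y (Y y))
    {J₀ : E → E} (hJ₀ : ∀ v, α y₀ (J₀ v) = Complex.I • α y₀ v) :
    VectorField.lieBracket ℝ JX JY y₀ - J₀ (VectorField.lieBracket ℝ JX Y y₀)
      - J₀ (VectorField.lieBracket ℝ X JY y₀) - VectorField.lieBracket ℝ X Y y₀ = 0 := by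
  have hinv := eventually_isInvertible hα.continuousAt e he
  -- Near `y₀`, `JX = α⁻¹(i α X)`, so `JX` inherits differentiability without any regularity
  -- assumption on `J`.
  have hdiff : ∀ {X JX : E → E}, DifferentiableAt ℝ X y₀ →
      (∀ᶠ y in 𝓝 y₀, α y (JX y) = Complex.I • α y (X y)) → DifferentiableAt ℝ JX y₀ := by
    intro X JX hX hJX
    have h : DifferentiableAt ℝ (fun y => (α y).inverse (Complex.I • α y (X y))) y₀ :=
      (differentiableAt_inverse_comp hα e he).clm_apply
        ((hα.clm_apply hX).const_smul Complex.I)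
    refine h.congr_of_eventuallyEq ?_
    filter_upwards [hinv, hJX] with y ⟨f, hf⟩ hy
    rw [← hy, ← hf]
    simp
  have hderiv : ∀ {X JX : E → E}, DifferentiableAt ℝ X y₀ →
      (∀ᶠ y in 𝓝 y₀, α y (JX y) = Complex.I • α y (X y)) → ∀ v,
      fderiv ℝ (fun z => α z (JX z)) y₀ v = Complex.I • fderiv ℝ (fun z => α z (X z)) y₀ v := by
    intro X JX hX hJX v
    have h3 : fderiv ℝ (fun z => Complex.I • α z (X z)) y₀ = _ :=
      ((hα.clm_apply hX).hasFDerivAt.const_smul Complex.I).fderiv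
    rw [Filter.EventuallyEq.fderiv_eq hJX, h3]
    simp
  have hdX := hdiff hX hJX
  have hdY := hdiff hY hJY
  have hinj : Function.Injective (α y₀) := by
    rw [← he]
    exact e.injective
  apply hinj
  -- With `dα = 0`, `α [X, Y]` is `X(α Y) - Y(α X)`. Pulling `i` out of the derivatives of `α(JX)`
  -- and `α(JY)` makes the eight resulting terms cancel in pairs.
  simp only [map_sub, map_zero, hJ₀, apply_lieBracket hα hX hY, apply_lieBracket hα hdX hY,
    apply_lieBracket hα hX hdY, apply_lieBracket hα hdX hdY, hcurl, hderiv hX hJX, hderiv hY hJY,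
    sub_zero, smul_sub, smul_smul, Complex.I_mul_I, neg_one_smul]
  abel

/-- If the exterior derivative of a coframe `α` has type `(0,2)` near `y₀`, and the fundamental
form of the Hermitian structure defined by `α` is closed at `y₀`, then `α` is closed at `y₀`. -/
theorem curlForm_eq_zero {α : E → E →L[ℝ] W} {y₀ : E} (hα : ContDiffAt ℝ 2 α y₀)
    (e : E ≃L[ℝ] W) (he : (e : E →L[ℝ] W) = α y₀)
    (h02 : ∀ᶠ y in 𝓝 y₀, ∀ v v' w, α y v' = Complex.I • α y v →
      curlForm α y v' w = -(Complex.I • curlForm α y v w))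
    (hω : ∀ u v w, (inner ℂ (α y₀ w) (curlForm α y₀ u v)).im
      + (inner ℂ (α y₀ u) (curlForm α y₀ v w)).im
      + (inner ℂ (α y₀ v) (curlForm α y₀ w u)).im = 0) (u v : E) :
    curlForm α y₀ u v = 0 := by
  -- `G y w` extends a vector `w` of `W` to the local field on which `α` is constantly `w`. The
  -- bracket at `y` is thus `curlForm α y (G y v) (G y w)`.
  set G : E → W →L[ℝ] E := fun y => (α y).inverse with hG
  have hG0 : G y₀ = e.symm := by simp [hG, ← he]
  have hαd : DifferentiableAt ℝ α y₀ := hα.differentiableAt (by norm_num)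
  have hGd : DifferentiableAt ℝ G y₀ := differentiableAt_inverse_comp hαd e he
  have hinv : ∀ᶠ y in 𝓝 y₀, ∀ x, α y (G y x) = x := by
    filter_upwards [eventually_isInvertible hα.continuousAt e he] with y ⟨f, hf⟩ x
    simp [hG, ← hf]
  have hαe : ∀ x, α y₀ (e.symm x) = x := fun x => by simp [← he]
  -- Differentiate `α G = id`.
  have hDG : ∀ x w, fderiv ℝ G y₀ x w = -e.symm (fderiv ℝ α y₀ x (e.symm w)) := by
    intro x w
    have h1 : HasFDerivAt (fun y => α y (G y w)) _ y₀ :=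
      hαd.hasFDerivAt.clm_apply (hGd.hasFDerivAt.clm_apply (hasFDerivAt_const w y₀))
    have h2 : HasFDerivAt (fun y => α y (G y w)) (0 : E →L[ℝ] W) y₀ :=
      (hasFDerivAt_const w y₀).congr_of_eventuallyEq (hinv.mono fun y hy => hy w)
    have h3 := congrArg (fun L => L x) (h1.unique h2)
    simp only [hG0, ← he] at h3
    simp at h3
    have h4 := congrArg e.symm h3
    simp at h4
    exact eq_neg_of_add_eq_zero_left h4
  have hβ : DifferentiableAt ℝ (fderiv ℝ α) y₀ :=
    (hα.fderiv_right (m := 1) (by norm_num)).differentiableAt one_ne_zero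
  have hsymm : ∀ x y, fderiv ℝ (fderiv ℝ α) y₀ x y = fderiv ℝ (fderiv ℝ α) y₀ y x := fun x y =>
    (hα.isSymmSndFDerivAt (by simp)) x y
  have hd : ∀ v w, HasFDerivAt (fun y => curlForm α y (G y v) (G y w)) _ y₀ := fun v w =>
    ((hβ.hasFDerivAt.clm_apply (hGd.hasFDerivAt.clm_apply (hasFDerivAt_const v y₀))).clm_apply
      (hGd.hasFDerivAt.clm_apply (hasFDerivAt_const w y₀))).sub
    ((hβ.hasFDerivAt.clm_apply (hGd.hasFDerivAt.clm_apply (hasFDerivAt_const w y₀))).clm_apply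
      (hGd.hasFDerivAt.clm_apply (hasFDerivAt_const v y₀)))
  have key : ∀ u v, curlForm α y₀ (e.symm u) (e.symm v) = 0 := by
    refine conjBilinear_eq_zero_of_bianchi
      (fun u v => curlForm α y₀ (e.symm u) (e.symm v))
      (fun u v w => fderiv ℝ (fun y => curlForm α y (G y v) (G y w)) y₀ (e.symm u))
      ?_ ?_ ?_ ?_ ?_ ?_
    · intro u v
      exact h02.self_of_nhds _ _ _ (by simp [hαe])
    · intro u v
      exact curlForm_swap _ _ _ _
    · intro u v w
      -- `D` differentiates the bracket, so conjugate-linearity is needed on a neighbourhood of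
      -- `y₀`, not only at `y₀`.
      have h1 : (fun y => curlForm α y (G y (Complex.I • v)) (G y w)) =ᶠ[𝓝 y₀]
          fun y => -(Complex.I • curlForm α y (G y v) (G y w)) := by
        filter_upwards [h02, hinv] with y h02 hinv
        exact h02 _ _ _ (by simp [hinv])
      have h2 := ((hd v w).differentiableAt.hasFDerivAt.const_smul Complex.I).neg
      have h3 : fderiv ℝ (fun y => -(Complex.I • curlForm α y (G y v) (G y w))) y₀ = _ := h2.fderiv
      rw [h1.fderiv_eq, h3]
      simp
    · intro u v w
      have h1 : (fun y => curlForm α y (G y v) (G y w)) =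
          fun y => -curlForm α y (G y w) (G y v) := funext fun y => curlForm_swap _ _ _ _
      rw [h1, fderiv_fun_neg]
      simp
    · intro u v w
      -- In the cyclic sum the second derivatives of `α` cancel by symmetry (`d² = 0`); the
      -- derivatives of `G`, given by `hDG`, combine into minus the `b (b u v) w` terms.
      rw [(hd v w).fderiv, (hd w u).fderiv, (hd u v).fderiv]
      simp only [hG0, curlForm]
      simp [hDG]
      rw [hsymm (e.symm u) (e.symm v), hsymm (e.symm v) (e.symm w), hsymm (e.symm w) (e.symm u)]
      abel
    · intro u v w
      simpa [hαe] using hω (e.symm u) (e.symm v) (e.symm w)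
  simpa using key (e u) (e v)

end LocalComputation

/-! ### Types and unitary coframes on a single tangent space. -/

namespace AlmostHermitian

section PointwiseAlgebra

variable {V : Type*} [AddCommGroup V] [Module ℝ V] (J : V →ₗ[ℝ] V)

lemma proj10_add_proj01 (Z : Cplx V) : proj10 J Z + proj01 J Z = Z := by
  simp only [proj10, proj01, LinearMap.smul_apply, LinearMap.sub_apply, LinearMap.add_apply,
    LinearMap.id_apply]
  module

variable {J}

lemma extendEnd_extendEnd (hJ : ∀ v, J (J v) = -v) (Z : Cplx V) :
    extendEnd J (extendEnd J Z) = -Z := by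
  induction Z using TensorProduct.induction_on with
  | zero => simp
  | tmul a v => simp [extendEnd_tmul, hJ, TensorProduct.tmul_neg]
  | add x y hx hy => rw [map_add, map_add, hx, hy, neg_add]

lemma proj10_mem (hJ : ∀ v, J (J v) = -v) (Z : Cplx V) : proj10 J Z ∈ space10 J := by
  rw [mem_space10]
  simp only [proj10, LinearMap.smul_apply, LinearMap.sub_apply, LinearMap.id_apply, map_smul,
    map_sub, extendEnd_extendEnd hJ]
  linear_combination (norm := module) (1 / 2 : ℂ) • (congrArg (· • extendEnd J Z) Complex.I_mul_I)

lemma proj01_mem (hJ : ∀ v, J (J v) = -v) (Z : Cplx V) : proj01 J Z ∈ space01 J := by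
  rw [mem_space01]
  simp only [proj01, LinearMap.smul_apply, LinearMap.add_apply, LinearMap.id_apply, map_smul,
    map_add, extendEnd_extendEnd hJ]
  linear_combination (norm := module) (1 / 2 : ℂ) • (congrArg (· • extendEnd J Z) Complex.I_mul_I)

lemma proj01_extendEnd (hJ : ∀ v, J (J v) = -v) (Z : Cplx V) :
    proj01 J (extendEnd J Z) = -Complex.I • proj01 J Z := by
  rw [← (mem_space01 J _).1 (proj01_mem hJ Z)]
  simp [proj01]

/-- A form vanishing on `V^{0,1}` is complex-linear. -/
lemma apply_J_of_extendLin_eq_zero (hJ : ∀ v, J (J v) = -v) {f : V →ₗ[ℝ] ℂ}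
    (hf : ∀ Z ∈ space01 J, extendLin f Z = 0) (v : V) : f (J v) = Complex.I * f v := by
  have h := hf _ (proj01_mem hJ (1 ⊗ₜ[ℝ] v))
  simp only [proj01, LinearMap.smul_apply, LinearMap.add_apply, LinearMap.id_apply, map_smul,
    map_add, extendEnd_tmul, extendLin_tmul, smul_eq_mul, one_mul] at h
  linear_combination -2 * Complex.I * h + f (J v) * Complex.I_mul_I

/-- A `2`-form without components of type `(2,0)` and `(1,1)` is conjugate-linear. -/
lemma apply_J_of_part20_of_part11 [TopologicalSpace V] (hJ : ∀ v, J (J v) = -v)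
    {α : V [⋀^Fin 2]→L[ℝ] ℂ} (h20 : part20 J α = 0) (h11 : part11 J α = 0) (v w : V) :
    α ![J v, w] = -(Complex.I * α ![v, w]) := by
  -- Only the (0,2)-part survives, and `J` acts on `V^{0,1}` as `-i`.
  have h : ∀ Z Z', extendTwoForm α Z Z' = extendTwoForm α (proj01 J Z) (proj01 J Z') := by
    intro Z Z'
    have h1 := LinearMap.congr_fun₂ h20 Z Z'
    have h2 := LinearMap.congr_fun₂ h11 Z Z'
    simp only [part20, part11, LinearMap.add_apply, LinearMap.compl₁₂_apply,
      LinearMap.zero_apply] at h1 h2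
    conv_lhs => rw [← proj10_add_proj01 J Z, ← proj10_add_proj01 J Z']
    simp only [map_add, LinearMap.add_apply]
    linear_combination h1 + h2
  have h3 : ∀ v w, α ![v, w] = extendTwoForm α (1 ⊗ₜ[ℝ] v) (1 ⊗ₜ[ℝ] w) := fun v w => by
    simp [extendTwoForm_tmul]
  rw [h3, h3, h, h (1 ⊗ₜ[ℝ] v), ← extendEnd_tmul, proj01_extendEnd hJ]
  simp

lemma conjC_smul (a : ℂ) (Z : Cplx V) : conjC (a • Z) = (starRingEnd ℂ a) • conjC Z := by
  induction Z using TensorProduct.induction_on with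
  | zero => simp
  | tmul b v => simp [conjC_tmul, TensorProduct.smul_tmul']
  | add x y hx hy => rw [smul_add, map_add, hx, hy, map_add, smul_add]

lemma conjC_proj10_tmul (v : V) :
    conjC (proj10 J (1 ⊗ₜ[ℝ] v)) = proj01 J (1 ⊗ₜ[ℝ] v) := by
  simp [proj10, proj01, conjC_smul, conjC_tmul, extendEnd_tmul, Complex.conj_ofNat]

/-- A Hermitian metric, expressed in a unitary coframe. -/
lemma metric_eq_of_unitary_coframe {n : ℕ} (hJ : ∀ v, J (J v) = -v) (g : V → V → ℝ)
    (B : V →ₗ[ℝ] V →ₗ[ℝ] ℂ) (hB : ∀ v w, B v w = g v w) (hg : ∀ v w, g (J v) (J w) = g v w)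
    (ζ : Fin n → V →ₗ[ℝ] ℂ) (hζ : ∀ i, ∀ Z ∈ space01 J, extendLin (ζ i) Z = 0)
    (Z : Module.Basis (Fin n) ℂ (space10 J))
    (hdual : ∀ i j, extendLin (ζ i) (Z j) = if i = j then 1 else 0)
    (hunit : ∀ i j, extendBilin B (Z i) (conjC (Z j : Cplx V)) = if i = j then 1 else 0)
    (v w : V) : g v w = 2 * (∑ i, starRingEnd ℂ (ζ i w) * ζ i v).re := by
  -- Each `ζ i` kills the (0,1)-part of `v`, so `ζ i v` is the `i`-th coordinate of its (1,0)-part.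
  have hexp : ∀ v, proj10 J (1 ⊗ₜ[ℝ] v) = ∑ i, ζ i v • (Z i : Cplx V) := by
    intro v
    have h1 := congrArg (Submodule.subtype _) (Z.sum_repr ⟨_, proj10_mem hJ (1 ⊗ₜ[ℝ] v)⟩)
    simp only [map_sum, map_smul, Submodule.subtype_apply] at h1
    rw [← h1]
    refine Finset.sum_congr rfl fun i _ => ?_
    congr 1
    have h2 := congrArg (extendLin (ζ i)) h1
    have h3 := congrArg (extendLin (ζ i)) (proj10_add_proj01 J (1 ⊗ₜ[ℝ] v))
    rw [map_add, hζ i _ (proj01_mem hJ _), add_zero, extendLin_tmul, one_mul] at h3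
    rw [← h3, ← h2]
    simp [hdual]
  have h1 : extendBilin B (proj10 J (1 ⊗ₜ[ℝ] v)) (proj01 J (1 ⊗ₜ[ℝ] w)) =
      ∑ i, starRingEnd ℂ (ζ i w) * ζ i v := by
    rw [← conjC_proj10_tmul, hexp, hexp]
    simp only [map_sum, conjC_smul, map_smul, LinearMap.sum_apply, LinearMap.smul_apply, hunit,
      smul_eq_mul]
    simp [mul_comm]
  -- The terms `g(v, w)` and `g(Jv, Jw)` agree and contribute a quarter each, hence the factor 2 in
  -- the conclusion; the mixed terms are purely imaginary.
  have h2 : extendBilin B (proj10 J (1 ⊗ₜ[ℝ] v)) (proj01 J (1 ⊗ₜ[ℝ] w)) =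
      (1 / 2 : ℂ) * g v w + Complex.I * ((1 / 4 : ℝ) * (g v (J w) - g (J v) w) : ℝ) := by
    simp only [proj10, proj01, LinearMap.smul_apply, LinearMap.sub_apply, LinearMap.add_apply,
      LinearMap.id_apply, map_smul, map_add, map_sub, extendEnd_tmul, extendBilin_tmul, hB, hg,
      smul_eq_mul, one_mul]
    push_cast
    linear_combination (-1 / 4 : ℂ) * g v w * Complex.I_mul_I
  rw [← h1, h2]
  simp

end PointwiseAlgebra

end AlmostHermitian

/-! ### Forms and exterior derivatives in charts. -/

namespace AlmostHermitian

section Charts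

open Filter Topology

variable {E : Type*} [NormedAddCommGroup E] [NormedSpace ℝ E]
  {H : Type*} [TopologicalSpace H] (I : ModelWithCorners ℝ E H)
  {M : Type*} [TopologicalSpace M] [ChartedSpace H M]
  {F : Type*} [NormedAddCommGroup F] [NormedSpace ℝ F]

/-- The derivative of the inverse of the chart at `x₀`. -/
noncomputable def chartSymmDeriv (x₀ : M) (y : E) : E →L[ℝ] TangentSpace I ((extChartAt I x₀).symm y) :=
  mfderivWithin 𝓘(ℝ, E) I (extChartAt I x₀).symm (range I) y

/-- The expression in the chart at `x₀` of a one-form on `M`. -/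
noncomputable def oneFormInChart (a : ∀ x : M, TangentSpace I x →L[ℝ] F) (x₀ : M) : E → E →L[ℝ] F := fun y =>
  (a ((extChartAt I x₀).symm y)).comp (chartSymmDeriv I x₀ y)

theorem formInChart_ofSubsingleton (a : ∀ x : M, TangentSpace I x →L[ℝ] F) (x₀ : M) :
    formInChart I (fun x => ContinuousAlternatingMap.ofSubsingleton ℝ (TangentSpace I x) F
      (0 : Fin 1) (a x)) x₀ =
    fun y => ContinuousAlternatingMap.ofSubsingleton ℝ E F (0 : Fin 1) (oneFormInChart I a x₀ y) :=
  rfl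

variable [IsManifold I ∞ M]

theorem mfderiv_extChartAt_comp_chartSymmDeriv {x₀ : M} {y : E}
    (hy : y ∈ (extChartAt I x₀).target) (v : E) :
    (mfderiv I 𝓘(ℝ, E) (extChartAt I x₀) ((extChartAt I x₀).symm y) :
      TangentSpace I ((extChartAt I x₀).symm y) →L[ℝ] E) (chartSymmDeriv I x₀ y v) = v := by
  have : IsManifold I 1 M := .of_le (n := ∞) (by simp)
  exact DFunLike.congr_fun (mfderiv_extChartAt_comp_mfderivWithin_extChartAt_symm hy) v

theorem chartSymmDeriv_comp_mfderiv_extChartAt {x₀ : M} {y : E}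
    (hy : y ∈ (extChartAt I x₀).target) (v : TangentSpace I ((extChartAt I x₀).symm y)) :
    chartSymmDeriv I x₀ y ((mfderiv I 𝓘(ℝ, E) (extChartAt I x₀) ((extChartAt I x₀).symm y) :
      TangentSpace I ((extChartAt I x₀).symm y) →L[ℝ] E) v) = v := by
  have : IsManifold I 1 M := .of_le (n := ∞) (by simp)
  exact DFunLike.congr_fun (mfderivWithin_extChartAt_symm_comp_mfderiv_extChartAt hy) v

theorem oneFormInChart_mfderiv_extChartAt (a : ∀ x : M, TangentSpace I x →L[ℝ] F) (x : M)
    (v : TangentSpace I x) :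
    oneFormInChart I a x (extChartAt I x x)
      ((mfderiv I 𝓘(ℝ, E) (extChartAt I x) x : TangentSpace I x →L[ℝ] E) v) = a x v := by
  have h := chartSymmDeriv_comp_mfderiv_extChartAt I (mem_extChartAt_target (I := I) x)
  rw [extChartAt_to_inv] at h
  -- All tangent spaces are definitionally `E`; forgetting the dependence on the point lets the base
  -- point be rewritten.
  let β : M → E →L[ℝ] F := a
  change β ((extChartAt I x).symm (extChartAt I x x)) _ = β x v
  rw [extChartAt_to_inv]
  exact congrArg _ (h v)

variable [I.Boundaryless]

/-- The chain rule through `M`. -/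
theorem fderiv_transition {x₀ x : M} {z : E} (hz : z ∈ (extChartAt I x).target)
    (hz' : (extChartAt I x).symm z ∈ (extChartAt I x₀).source) (v : E) :
    fderiv ℝ (extChartAt I x₀ ∘ (extChartAt I x).symm) z v =
      (mfderiv I 𝓘(ℝ, E) (extChartAt I x₀) ((extChartAt I x).symm z) :
        TangentSpace I ((extChartAt I x).symm z) →L[ℝ] E) (chartSymmDeriv I x z v) := by
  have : IsManifold I 1 M := .of_le (n := ∞) (by simp)
  have h1 : MDifferentiableAt 𝓘(ℝ, E) I (extChartAt I x).symm z := by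
    have h := mdifferentiableWithinAt_extChartAt_symm hz
    rwa [I.range_eq_univ, mdifferentiableWithinAt_univ] at h
  have h2 : MDifferentiableAt I 𝓘(ℝ, E) (extChartAt I x₀) ((extChartAt I x).symm z) :=
    mdifferentiableAt_extChartAt (by rwa [extChartAt_source] at hz')
  rw [← mfderiv_eq_fderiv, mfderiv_comp z h2 h1]
  simp only [chartSymmDeriv, I.range_eq_univ, mfderivWithin_univ]
  rfl

/-- The expressions of a form in two charts are related by the derivative of the transition. -/
theorem formInChart_eventuallyEq {k : ℕ} (α : ∀ x : M, TangentSpace I x [⋀^Fin k]→L[ℝ] F)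
    {x₀ x : M} (hx : x ∈ (extChartAt I x₀).source) :
    formInChart I α x =ᶠ[𝓝 (extChartAt I x x)] fun z =>
      (formInChart I α x₀ ((extChartAt I x₀ ∘ (extChartAt I x).symm) z)).compContinuousLinearMap
        (fderiv ℝ (extChartAt I x₀ ∘ (extChartAt I x).symm) z) := by
  have h1 : ∀ᶠ z in 𝓝 (extChartAt I x x), (extChartAt I x).symm z ∈ (extChartAt I x₀).source := by
    have h := continuousAt_extChartAt_symm (I := I) x
    refine h.eventually_mem ?_
    rw [extChartAt_to_inv]
    exact (isOpen_extChartAt_source x₀).mem_nhds hx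
  filter_upwards [h1, extChartAt_target_mem_nhds (I := I) x] with z hz' hz
  ext v
  have hinv : (extChartAt I x₀).symm (extChartAt I x₀ ((extChartAt I x).symm z)) =
      (extChartAt I x).symm z := (extChartAt I x₀).left_inv hz'
  have hT : ∀ u : E, (chartSymmDeriv I x₀ (extChartAt I x₀ ((extChartAt I x).symm z))
      (fderiv ℝ (extChartAt I x₀ ∘ (extChartAt I x).symm) z u) : E) = chartSymmDeriv I x z u := by
    intro u
    rw [fderiv_transition I hz hz']
    have h := chartSymmDeriv_comp_mfderiv_extChartAt I ((extChartAt I x₀).map_source hz')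
    rw [hinv] at h
    exact h _
  let β : M → E [⋀^Fin k]→L[ℝ] F := α
  change β ((extChartAt I x).symm z) (fun i => (chartSymmDeriv I x z (v i) : E)) =
    β ((extChartAt I x₀).symm (extChartAt I x₀ ((extChartAt I x).symm z)))
      (fun i => (chartSymmDeriv I x₀ (extChartAt I x₀ ((extChartAt I x).symm z))
      (fderiv ℝ (extChartAt I x₀ ∘ (extChartAt I x).symm) z (v i)) : E))
  rw [hinv]
  congr 1
  ext i
  exact (hT _).symm

/-- The exterior derivative may be computed in any chart. -/
theorem extD_eq_extDeriv_formInChart {k : ℕ} (α : ∀ x : M, TangentSpace I x [⋀^Fin k]→L[ℝ] F)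
    {x₀ x : M} (hx : x ∈ (extChartAt I x₀).source)
    (hα : DifferentiableAt ℝ (formInChart I α x₀) (extChartAt I x₀ x)) :
    extD I α x = (extDeriv (formInChart I α x₀) (extChartAt I x₀ x) :
      E [⋀^Fin (k + 1)]→L[ℝ] F).compContinuousLinearMap
        (mfderiv I 𝓘(ℝ, E) (extChartAt I x₀) x) := by
  have hψx : (extChartAt I x₀ ∘ (extChartAt I x).symm) (extChartAt I x x) = extChartAt I x₀ x := by
    simp
  have hψ : ContDiffAt ℝ 2 (extChartAt I x₀ ∘ (extChartAt I x).symm) (extChartAt I x x) := by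
    have h1 : ContMDiffAt 𝓘(ℝ, E) I ∞ (extChartAt I x).symm (extChartAt I x x) :=
      (contMDiffOn_extChartAt_symm x).contMDiffAt (extChartAt_target_mem_nhds x)
    have h2 : ContMDiffAt I 𝓘(ℝ, E) ∞ (extChartAt I x₀) x :=
      contMDiffAt_extChartAt' (by rwa [extChartAt_source] at hx)
    exact (ContMDiffAt.comp_of_eq h2 h1 (by simp)).contDiffAt.of_le (WithTop.coe_le_coe.2 le_top)
  -- `extD` at `x` uses the chart centred at `x`. Naturality of `d` under the transition map moves
  -- it to the fixed chart at `x₀`, so that `x` can vary.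
  have h := (formInChart_eventuallyEq I α hx).extDeriv_eq
  rw [← hψx] at hα
  rw [extDeriv_pullback hα hψ (by simp), hψx] at h
  rw [extD, I.range_eq_univ, extDerivWithin_univ, h]
  ext v
  change (extDeriv (formInChart I α x₀) (extChartAt I x₀ x)) _ =
    (extDeriv (formInChart I α x₀) (extChartAt I x₀ x)) _
  congr 1
  ext i
  have hz := mem_extChartAt_target (I := I) x
  have h1 := fderiv_transition I hz (by simpa using hx) (x₀ := x₀)
  have h2 := chartSymmDeriv_comp_mfderiv_extChartAt I hz
  rw [extChartAt_to_inv] at h1 h2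
  exact (h1 _).trans (congrArg _ (h2 (v i)))

/-- The exterior derivative of a one-form, computed in a chart. -/
theorem extD_ofSubsingleton_apply (a : ∀ x : M, TangentSpace I x →L[ℝ] F) {x₀ : M} {y : E}
    (hy : y ∈ (extChartAt I x₀).target)
    (ha : DifferentiableAt ℝ (oneFormInChart I a x₀) y) (u v : E) :
    extD I (fun x => ContinuousAlternatingMap.ofSubsingleton ℝ (TangentSpace I x) F
      (0 : Fin 1) (a x)) ((extChartAt I x₀).symm y)
        ![chartSymmDeriv I x₀ y u, chartSymmDeriv I x₀ y v] =
      curlForm (oneFormInChart I a x₀) y u v := by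
  have hx := (extChartAt I x₀).map_target hy
  have hr := (extChartAt I x₀).right_inv hy
  have hd : DifferentiableAt ℝ (fun y => ContinuousAlternatingMap.ofSubsingleton ℝ E F (0 : Fin 1)
      (oneFormInChart I a x₀ y)) y :=
    (ContinuousAlternatingMap.ofSubsingletonLIE (𝕜 := ℝ) (E := E) (F := F)
      (0 : Fin 1)).differentiableAt.comp y ha
  rw [extD_eq_extDeriv_formInChart I _ hx (by rwa [hr, formInChart_ofSubsingleton]), hr,
    formInChart_ofSubsingleton, ← extDeriv_ofSubsingleton_apply ha]
  change (extDeriv _ y) _ = (extDeriv _ y) _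
  congr 1
  ext i
  fin_cases i
  · exact mfderiv_extChartAt_comp_chartSymmDeriv I hy u
  · exact mfderiv_extChartAt_comp_chartSymmDeriv I hy v

/-- Smoothness of a section of the hom bundle is read in the trivialization at `x₀`, whose inverse
on the tangent bundle is the derivative of the inverse chart; the coordinate expression is therefore
`oneFormInChart`. -/
theorem contDiffAt_oneFormInChart (a : ∀ x : M, TangentSpace I x →L[ℝ] F)
    (ha : ContMDiff I (I.prod 𝓘(ℝ, E →L[ℝ] F)) ∞
      (fun x => TotalSpace.mk' (E →L[ℝ] F) (E := fun x : M => TangentSpace I x →L[ℝ] F) x (a x)))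
    (x₀ : M) : ContDiffAt ℝ ∞ (oneFormInChart I a x₀) (extChartAt I x₀ x₀) := by
  have h1 := ((contMDiffAt_hom_bundle _).1 (ha x₀)).2
  have h2 : ContMDiffAt 𝓘(ℝ, E) I ∞ (extChartAt I x₀).symm (extChartAt I x₀ x₀) :=
    (contMDiffOn_extChartAt_symm x₀).contMDiffAt (extChartAt_target_mem_nhds x₀)
  have h3 : extChartAt I x₀ x₀ ∈ (extChartAt I x₀).target := mem_extChartAt_target x₀
  have h4 := ContMDiffAt.comp_of_eq h1 h2 (by simp)
  rw [← contMDiffAt_iff_contDiffAt]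
  refine h4.congr_of_eventuallyEq ?_
  filter_upwards [extChartAt_target_mem_nhds (I := I) x₀] with y hy
  have hy' : (extChartAt I x₀).symm y ∈ (chartAt H x₀).source := by
    rw [← extChartAt_source I]
    exact (extChartAt I x₀).map_target hy
  simp only [Function.comp_def, ContinuousLinearMap.inCoordinates]
  rw [TangentBundle.symmL_trivializationAt hy', (extChartAt I x₀).right_inv hy]
  simp
  rfl

end Charts

end AlmostHermitian

/-! ### The coframe as a map to `ℂⁿ`, and its closedness. -/

namespace AlmostHermitian

namespace Structure

open Filter Topology

variable {n : ℕ} {M : Type*} [TopologicalSpace M]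
  [ChartedSpace (EuclideanSpace ℝ (Fin (2 * n))) M] [IsManifold (𝓡 (2 * n)) ∞ M]
  {S : Structure n M}

/-- The linear map `T_xM → ℂⁿ` whose components are the forms `ζ₁, …, ζₙ`. -/
noncomputable def coframeMap (ζ : Fin n → S.Form10) (x : M) :
    TangentSpace (𝓡 (2 * n)) x →L[ℝ] EuclideanSpace ℂ (Fin n) :=
  ((EuclideanSpace.equiv (Fin n) ℂ).symm.toContinuousLinearMap.restrictScalars ℝ).comp
    (ContinuousLinearMap.pi fun i => (ζ i).toFun x)

lemma coframeMap_apply (ζ : Fin n → S.Form10) (x : M) (v : TangentSpace (𝓡 (2 * n)) x)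
    (i : Fin n) : coframeMap ζ x v i = (ζ i).toFun x v := rfl

lemma coframeMap_J (ζ : Fin n → S.Form10) (x : M) (v : TangentSpace (𝓡 (2 * n)) x) :
    coframeMap ζ x (S.J x v) = Complex.I • coframeMap ζ x v := by
  ext i
  exact apply_J_of_extendLin_eq_zero (J := (S.J x).toLinearMap) (S.J_J x) ((ζ i).type10 x) v

lemma metric_eq {ζ : Fin n → S.Form10} (hζ : S.IsUnitaryCoframe ζ) (x : M)
    (v w : TangentSpace (𝓡 (2 * n)) x) :
    S.g.inner x v w = 2 * (inner ℂ (coframeMap ζ x w) (coframeMap ζ x v)).re := by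
  obtain ⟨Z, hdual, hunit⟩ := hζ x
  have h := metric_eq_of_unitary_coframe (J := (S.J x).toLinearMap) (S.J_J x)
    (fun v w => S.g.inner x v w) _ (fun v w => rfl) (S.g_J_J x) (fun i => (ζ i).toFun x)
    (fun i => (ζ i).type10 x) Z hdual hunit v w
  rw [h, PiLp.inner_apply]
  simp [coframeMap_apply, mul_comm]

lemma fundamentalForm_apply {ζ : Fin n → S.Form10} (hζ : S.IsUnitaryCoframe ζ) (x : M)
    (v : Fin 2 → TangentSpace (𝓡 (2 * n)) x) :
    S.fundamentalForm x v =
      -2 * (inner ℂ (coframeMap ζ x (v 1)) (coframeMap ζ x (v 0))).im := by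
  change S.g.inner x (S.J x (v 0)) (v 1) = _
  rw [metric_eq hζ, coframeMap_J, inner_smul_right, Complex.I_mul_re]
  ring

/-- By `metric_eq`, a vector killed by the coframe has `g`-norm zero. -/
lemma coframeMap_injective {ζ : Fin n → S.Form10} (hζ : S.IsUnitaryCoframe ζ) (x : M) :
    Function.Injective (coframeMap ζ x) := by
  rw [injective_iff_map_eq_zero]
  intro v hv
  by_contra hne
  have h := S.g.pos x v hne
  rw [metric_eq hζ, hv] at h
  simp at h

lemma d_J {ζ : S.Form10} {x : M} (hdel : ζ.del x = 0) (hdelbar : ζ.delbar x = 0)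
    (v w : TangentSpace (𝓡 (2 * n)) x) :
    ζ.d x ![S.J x v, w] = -(Complex.I * ζ.d x ![v, w]) :=
  apply_J_of_part20_of_part11 (J := (S.J x).toLinearMap) (S.J_J x) hdel hdelbar v w

/-- The expression of a coframe in the chart at `x₀`. -/
noncomputable abbrev coframeInChart (ζ : Fin n → S.Form10) (x₀ : M) :
    EuclideanSpace ℝ (Fin (2 * n)) →
      EuclideanSpace ℝ (Fin (2 * n)) →L[ℝ] EuclideanSpace ℂ (Fin n) :=
  oneFormInChart (𝓡 (2 * n)) (coframeMap ζ) x₀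

lemma contDiffAt_coframeInChart (ζ : Fin n → S.Form10) (x₀ : M) :
    ContDiffAt ℝ 2 (coframeInChart ζ x₀) (extChartAt (𝓡 (2 * n)) x₀ x₀) := by
  have h : coframeInChart ζ x₀ = fun y => ∑ i,
      (((EuclideanSpace.equiv (Fin n) ℂ).symm.toContinuousLinearMap.restrictScalars ℝ).comp
        (ContinuousLinearMap.single ℝ (fun _ : Fin n => ℂ) i)).comp
        (oneFormInChart (𝓡 (2 * n)) (ζ i).toFun x₀ y) := by
    funext y
    ext v i
    simp [Pi.single_apply]
    rfl
  rw [h]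
  exact ContDiffAt.sum fun i _ => contDiffAt_const.clm_comp
    ((contDiffAt_oneFormInChart (𝓡 (2 * n)) (ζ i).toFun (ζ i).contMDiff x₀).of_le
      (WithTop.coe_le_coe.2 le_top))

lemma chartSymmDeriv_injective {x₀ : M} {y : EuclideanSpace ℝ (Fin (2 * n))}
    (hy : y ∈ (extChartAt (𝓡 (2 * n)) x₀).target) :
    Function.Injective (chartSymmDeriv (𝓡 (2 * n)) x₀ y) :=
  Function.LeftInverse.injective (mfderiv_extChartAt_comp_chartSymmDeriv (𝓡 (2 * n)) hy)

/-- An injective real-linear map between spaces of real dimension `2n`. -/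
lemma exists_equiv_coframeInChart {ζ : Fin n → S.Form10} (hζ : S.IsUnitaryCoframe ζ) {x₀ : M}
    {y : EuclideanSpace ℝ (Fin (2 * n))} (hy : y ∈ (extChartAt (𝓡 (2 * n)) x₀).target) :
    ∃ e : EuclideanSpace ℝ (Fin (2 * n)) ≃L[ℝ] EuclideanSpace ℂ (Fin n),
      (e : EuclideanSpace ℝ (Fin (2 * n)) →L[ℝ] EuclideanSpace ℂ (Fin n)) =
        coframeInChart ζ x₀ y := by
  have hinj : Function.Injective (coframeInChart ζ x₀ y) :=
    (coframeMap_injective hζ _).comp (chartSymmDeriv_injective hy)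
  have hrank : Module.finrank ℝ (EuclideanSpace ℝ (Fin (2 * n))) =
      Module.finrank ℝ (EuclideanSpace ℂ (Fin n)) := by
    rw [finrank_real_of_complex]
    simp
  refine ⟨(LinearEquiv.ofInjectiveOfFinrankEq (coframeInChart ζ x₀ y).toLinearMap hinj
    hrank).toContinuousLinearEquiv, ?_⟩
  ext v
  rfl

/-- The exterior derivative of a coframe with `∂ζ_i = ∂̄ζ_i = 0` is conjugate-linear, in a
chart. -/
lemma curlForm_coframeInChart_J {ζ : Fin n → S.Form10} (hζ : S.IsUnitaryCoframe ζ)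
    (hdel : ∀ i x, (ζ i).del x = 0) (hdelbar : ∀ i x, (ζ i).delbar x = 0) {x₀ : M}
    {y : EuclideanSpace ℝ (Fin (2 * n))} (hy : y ∈ (extChartAt (𝓡 (2 * n)) x₀).target)
    (hd : DifferentiableAt ℝ (coframeInChart ζ x₀) y) (v v' w : EuclideanSpace ℝ (Fin (2 * n)))
    (h : coframeInChart ζ x₀ y v' = Complex.I • coframeInChart ζ x₀ y v) :
    curlForm (coframeInChart ζ x₀) y v' w =
      -(Complex.I • curlForm (coframeInChart ζ x₀) y v w) := by
  -- Injectivity of the coframe turns the relation `α v' = i α v` into `v' = J v` on the manifold.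
  have hT : chartSymmDeriv (𝓡 (2 * n)) x₀ y v' = S.J _ (chartSymmDeriv (𝓡 (2 * n)) x₀ y v) := by
    apply coframeMap_injective hζ
    rw [coframeMap_J]
    exact h
  ext i
  have hcomp : oneFormInChart (𝓡 (2 * n)) (ζ i).toFun x₀ = fun z =>
      ((EuclideanSpace.proj i : EuclideanSpace ℂ (Fin n) →L[ℂ] ℂ).restrictScalars ℝ).comp
        (coframeInChart ζ x₀ z) := rfl
  have hdi : DifferentiableAt ℝ (oneFormInChart (𝓡 (2 * n)) (ζ i).toFun x₀) y := by
    rw [hcomp]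
    exact (differentiableAt_const _).clm_comp hd
  have hi : ∀ v, curlForm (coframeInChart ζ x₀) y v w i = (ζ i).d _
      ![chartSymmDeriv (𝓡 (2 * n)) x₀ y v, chartSymmDeriv (𝓡 (2 * n)) x₀ y w] := by
    intro v
    have h1 := extD_ofSubsingleton_apply (𝓡 (2 * n)) (ζ i).toFun hy hdi v w
    rw [hcomp, curlForm_comp _ hd] at h1
    exact h1.symm
  rw [PiLp.neg_apply, PiLp.smul_apply, hi, hi, hT, d_J (hdel i _) (hdelbar i _)]
  rfl

/-- Here the hypotheses meet: the types of `dζ_i` near `x₀` and `dω = 0` at `x₀` feed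
`curlForm_eq_zero`. -/
lemma curlForm_coframeInChart_eq_zero (hS : S.IsAlmostKahler) {ζ : Fin n → S.Form10}
    (hζ : S.IsUnitaryCoframe ζ) (hdel : ∀ i x, (ζ i).del x = 0)
    (hdelbar : ∀ i x, (ζ i).delbar x = 0) (x₀ : M) (u v : EuclideanSpace ℝ (Fin (2 * n))) :
    curlForm (coframeInChart ζ x₀) (extChartAt (𝓡 (2 * n)) x₀ x₀) u v = 0 := by
  have hy₀ := mem_extChartAt_target (I := 𝓡 (2 * n)) x₀
  have hα := contDiffAt_coframeInChart ζ x₀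
  obtain ⟨e, he⟩ := exists_equiv_coframeInChart hζ hy₀
  refine curlForm_eq_zero hα e he ?_ ?_ u v
  · filter_upwards [hα.eventually (by simp), extChartAt_target_mem_nhds (I := 𝓡 (2 * n)) x₀]
      with y hd hy v v' w h
    exact curlForm_coframeInChart_J hζ hdel hdelbar hy (hd.differentiableAt (by simp)) v v' w h
  -- `ω` at `x₀`, transported to `ℂⁿ` by the coframe. By `hΩ'` the result is a universal formula, so
  -- the same `Ω` represents `ω` at every point.
  · set Ω : EuclideanSpace ℂ (Fin n) [⋀^Fin 2]→L[ℝ] ℝ :=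
      (S.fundamentalForm _).compContinuousLinearMap ((chartSymmDeriv (𝓡 (2 * n)) x₀
        (extChartAt (𝓡 (2 * n)) x₀ x₀)).comp e.symm.toContinuousLinearMap) with hΩ
    have hΩ' : ∀ v, Ω v = -2 * (inner ℂ (v 1) (v 0)).im := by
      intro v
      have h : ∀ w, coframeMap ζ _ (chartSymmDeriv (𝓡 (2 * n)) x₀
          (extChartAt (𝓡 (2 * n)) x₀ x₀) (e.symm w)) = w := fun w => by
        change coframeInChart ζ x₀ (extChartAt (𝓡 (2 * n)) x₀ x₀) (e.symm w) = w
        rw [← he]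
        simp
      change S.fundamentalForm _ (fun i => chartSymmDeriv (𝓡 (2 * n)) x₀
          (extChartAt (𝓡 (2 * n)) x₀ x₀) (e.symm (v i))) = _
      rw [fundamentalForm_apply hζ, h, h]
    have hform : formInChart (𝓡 (2 * n)) S.fundamentalForm x₀ = fun y =>
        Ω.compContinuousLinearMap (coframeInChart ζ x₀ y) := by
      funext y
      ext v
      change S.fundamentalForm _ (fun i => chartSymmDeriv (𝓡 (2 * n)) x₀ y (v i)) =
        Ω (fun i => coframeInChart ζ x₀ y (v i))
      rw [fundamentalForm_apply hζ, hΩ']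
      rfl
    refine cyclic_curlForm_of_extDeriv_eq_zero (hα.differentiableAt (by simp)) Ω (-2) (by norm_num)
      (fun u v => hΩ' _) ?_
    have h := hS x₀
    rw [extD, (𝓡 (2 * n)).range_eq_univ, extDerivWithin_univ, hform] at h
    ext v
    have h1 := mfderiv_extChartAt_comp_chartSymmDeriv (𝓡 (2 * n)) hy₀
    rw [extChartAt_to_inv] at h1
    -- Feeding in images under the inverse chart derivative cancels the chart derivative built into
    -- `extD`.
    have h2 := DFunLike.congr_fun h fun i => chartSymmDeriv (𝓡 (2 * n)) x₀
      (extChartAt (𝓡 (2 * n)) x₀ x₀) (v i)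
    refine Eq.trans ?_ h2
    change (extDeriv _ _) _ = (extDeriv _ _) _
    congr 1
    ext1 i
    exact (h1 (v i)).symm

/-! ### Vector fields in charts and the Nijenhuis tensor. -/

/-- The expression in the chart at `x₀` of a vector field on `M`. -/
noncomputable abbrev fieldInChart (X : ∀ x : M, TangentSpace (𝓡 (2 * n)) x) (x₀ : M) :
    EuclideanSpace ℝ (Fin (2 * n)) → EuclideanSpace ℝ (Fin (2 * n)) :=
  VectorField.mpullbackWithin 𝓘(ℝ, EuclideanSpace ℝ (Fin (2 * n))) (𝓡 (2 * n))
    (extChartAt (𝓡 (2 * n)) x₀).symm X (range (𝓡 (2 * n)))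

lemma differentiableAt_fieldInChart {X : ∀ x : M, TangentSpace (𝓡 (2 * n)) x}
    (hX : ContMDiff (𝓡 (2 * n)) (𝓡 (2 * n)).tangent ∞
      (fun x => (⟨x, X x⟩ : TangentBundle (𝓡 (2 * n)) M))) (x₀ : M) :
    DifferentiableAt ℝ (fieldInChart X x₀) (extChartAt (𝓡 (2 * n)) x₀ x₀) := by
  have h := VectorField.contMDiffWithinAt_mpullbackWithin_extChartAt_symm (n := ∞) (m := 1)
    ((hX x₀).of_le (WithTop.coe_le_coe.2 le_top)).contMDiffWithinAt uniqueMDiffOn_univ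
    (mem_univ x₀) (WithTop.coe_le_coe.2 le_top)
  rw [preimage_univ, inter_univ] at h
  have h' := h.contMDiffAt (extChartAt_target_mem_nhds x₀)
  rw [contMDiffAt_vectorSpace_iff_contDiffAt] at h'
  exact h'.differentiableAt one_ne_zero

lemma chartSymmDeriv_fieldInChart (X : ∀ x : M, TangentSpace (𝓡 (2 * n)) x) {x₀ : M}
    {y : EuclideanSpace ℝ (Fin (2 * n))} (hy : y ∈ (extChartAt (𝓡 (2 * n)) x₀).target) :
    chartSymmDeriv (𝓡 (2 * n)) x₀ y (fieldInChart X x₀ y) =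
      X ((extChartAt (𝓡 (2 * n)) x₀).symm y) := by
  have : IsManifold (𝓡 (2 * n)) 1 M := .of_le (n := ∞) (by simp)
  exact (isInvertible_mfderivWithin_extChartAt_symm hy).self_apply_inverse _

lemma mlieBracket_eq_lieBracket_fieldInChart (X Y : ∀ x : M, TangentSpace (𝓡 (2 * n)) x)
    (x : M) : VectorField.mlieBracket (𝓡 (2 * n)) X Y x =
      (mfderiv (𝓡 (2 * n)) 𝓘(ℝ, EuclideanSpace ℝ (Fin (2 * n)))
        (extChartAt (𝓡 (2 * n)) x) x).inverse
        (VectorField.lieBracket ℝ (fieldInChart X x) (fieldInChart Y x)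
          (extChartAt (𝓡 (2 * n)) x x)) := by
  have h : VectorField.lieBracketWithin ℝ (fieldInChart X x) (fieldInChart Y x)
      ((extChartAt (𝓡 (2 * n)) x).symm ⁻¹' univ ∩ range (𝓡 (2 * n))) =
      VectorField.lieBracket ℝ (fieldInChart X x) (fieldInChart Y x) := by
    rw [preimage_univ, univ_inter, (𝓡 (2 * n)).range_eq_univ, VectorField.lieBracketWithin_univ]
  rw [← VectorField.mlieBracketWithin_univ, VectorField.mlieBracketWithin_apply]
  exact congrArg (fun L => (mfderiv (𝓡 (2 * n)) 𝓘(ℝ, EuclideanSpace ℝ (Fin (2 * n)))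
    (extChartAt (𝓡 (2 * n)) x) x).inverse (L (extChartAt (𝓡 (2 * n)) x x))) h

/-- An almost Kähler structure with a unitary `(1,0)`-coframe `ζ` such that `∂ζ_i = ∂̄ζ_i = 0` is
integrable. -/
theorem isIntegrable_of_unitaryCoframe (hS : S.IsAlmostKahler) {ζ : Fin n → S.Form10}
    (hζ : S.IsUnitaryCoframe ζ) (hdel : ∀ i x, (ζ i).del x = 0)
    (hdelbar : ∀ i x, (ζ i).delbar x = 0) : S.IsIntegrable := by
  intro X Y hX hY x
  have hy₀ := mem_extChartAt_target (I := 𝓡 (2 * n)) x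
  have hα := contDiffAt_coframeInChart ζ x
  obtain ⟨e, he⟩ := exists_equiv_coframeInChart hζ hy₀
  have : IsManifold (𝓡 (2 * n)) 1 M := .of_le (n := ∞) (by simp)
  have hD := isInvertible_mfderiv_extChartAt (mem_extChartAt_source (I := 𝓡 (2 * n)) x)
  set D : TangentSpace (𝓡 (2 * n)) x →L[ℝ] EuclideanSpace ℝ (Fin (2 * n)) :=
    mfderiv (𝓡 (2 * n)) 𝓘(ℝ, EuclideanSpace ℝ (Fin (2 * n))) (extChartAt (𝓡 (2 * n)) x) x with hDdef
  have hJfield : ∀ X : ∀ x : M, TangentSpace (𝓡 (2 * n)) x,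
      ∀ᶠ y in 𝓝 (extChartAt (𝓡 (2 * n)) x x), coframeInChart ζ x y (fieldInChart (S.Jfield X) x y) =
        Complex.I • coframeInChart ζ x y (fieldInChart X x y) := by
    intro X
    filter_upwards [extChartAt_target_mem_nhds (I := 𝓡 (2 * n)) x] with y hy
    change coframeMap ζ _ (chartSymmDeriv (𝓡 (2 * n)) x y _) =
      Complex.I • coframeMap ζ _ (chartSymmDeriv (𝓡 (2 * n)) x y _)
    rw [chartSymmDeriv_fieldInChart _ hy, chartSymmDeriv_fieldInChart _ hy]
    exact coframeMap_J ζ _ _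
  have hαD : ∀ v, coframeInChart ζ x (extChartAt (𝓡 (2 * n)) x x) (D v) = coframeMap ζ x v :=
    oneFormInChart_mfderiv_extChartAt (𝓡 (2 * n)) (coframeMap ζ) x
  have hDinv : ∀ v, D (D.inverse v) = v := fun v => hD.self_apply_inverse v
  have hinvD : ∀ v, D.inverse (D v) = v := fun v => hD.inverse_apply_self v
  -- `J₀` is `J` at `x` conjugated by the chart derivative `D`; applying `D⁻¹` afterwards returns
  -- the identity to the tangent space at `x`.
  have key := nijenhuis_eq_zero_of_curlForm_eq_zero (hα.differentiableAt (by simp)) e he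
    (curlForm_coframeInChart_eq_zero hS hζ hdel hdelbar x)
    (differentiableAt_fieldInChart hX x) (differentiableAt_fieldInChart hY x)
    (hJfield X) (hJfield Y) (J₀ := fun v => D (S.J x (D.inverse v)))
    (fun v => by rw [hαD, coframeMap_J, ← hαD, hDinv])
  have key' := congrArg D.inverse key
  simp only [map_sub, map_zero, hinvD] at key'
  rw [nijenhuis]
  simp only [mlieBracket_eq_lieBracket_fieldInChart]
  exact key'

end Structure

end AlmostHermitian

theorem mainTheorem8 {n : ℕ} {M : Type*} [TopologicalSpace M] [T2Space M]
    [ChartedSpace (EuclideanSpace ℝ (Fin (2 * n))) M] [IsManifold (𝓡 (2 * n)) ∞ M]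
    (S : AlmostHermitian.Structure n M) (hS : S.IsAlmostKahler)
    (ζ : Fin n → S.Form10) (hζ : S.IsUnitaryCoframe ζ)
    (hdel : ∀ i x, (ζ i).del x = 0) (hdelbar : ∀ i x, (ζ i).delbar x = 0) :
    S.IsIntegrable ∧ S.IsKahler := by
  have h := AlmostHermitian.Structure.isIntegrable_of_unitaryCoframe hS hζ hdel hdelbar
  exact ⟨h, h, hS⟩
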